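/- Let $I=(-L,L)$ with $0<L\le\infty$, let $H=L^2(I)$ (real-valued) with inner product $(u,v)=\int_I uv\,dx$ and norm $|\cdot|$, and let $V=H^1_0(I)$ (Dirichlet condition) or $V=H^1(I)$ (Neumann condition), with the inner product $((u,v))=(u,v)+(u_x,v_x)$ and dual $V^*$; thus $V\subset H\subset V^*$, where $h\in H$ acts on $V$ by $v\mapsto(h,v)$. Let $\kappa\ge 0$ and let $\mathcal A:V\to V^*$ be defined by $\langle\mathcal Au,v\rangle=(u_x,v_x)+\kappa(u,v)$ ($\kappa=0$: no regularization). Let $D(\mathcal A)=\{v\in V:\ \mathcal Av\in H\}$ with the graph norm $(\|v\|^2+|\mathcal Av|^2)^{1/2}$, which is equivalent to $|\mathcal Av|$ whenever the form $\langle \mathcal Au,v\rangle$ is coercive on $V$. Let $T>0$, $\epsilon>0$, let $\phi(x,t)$ be a measurable function, let $g\in L^2(0,T;H)$, and for $u\in H$ put $$f(t,u)(x)=\epsilon^{-1}\bigl(\sin\phi(x,t)-\sin(\phi(x,t)+\epsilon u(x))\bigr)+g(x,t),\qquad x\in I.$$ Let $u_0\in V$, $v_0\in H$, and let $\eta$ be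 a weak solution of $$\eta''+\mathcal A\eta=f(t,\eta),\qquad \eta(0)=u_0,\quad \eta'(0)=v_0,$$ that is, $\eta\in L^2(0,T;V)$, $\eta'\in L^2(0,T;H)$, $\eta''\in L^2(0,T;V^*)$ (with derivatives in $t$ in the sense of distributions with values in $H$ and $V^*$), the equation holds in $V^*$ for almost every $t\in(0,T)$, and the initial conditions hold for the continuous representatives of $\eta$ and $\eta'$. If $u_0\in D(\mathcal A)$, $v_0\in V$ and the function $t\mapsto f(t,\eta(t))$ belongs to $L^2(0,T;V)$, then, after modification on a set of measure zero, $$\eta\in C([0,T];D(\mathcal A)),\qquad \eta'\in C([0,T];V),\qquad \eta''\in L^2(0,T;H).$$ -/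

import Mathlib

open MeasureTheory Set Filter Topology
open scoped ENNReal ContDiff

noncomputable section

namespace SineGordon

/-- `ψ` is a test function on `s`: smooth, with compact support contained in `s`. -/
structure IsTestFunction (s : Set ℝ) (ψ : ℝ → ℝ) : Prop where
  contDiff : ContDiff ℝ ∞ ψ
  hasCompactSupport : HasCompactSupport ψ
  tsupport_subset : tsupport ψ ⊆ s

/-- `w` is the derivative of `u` on the open set `s` in the sense of (vector-valued)
distributions. It is used both in space (`X = ℝ`) and in time (`X` a Banach space), always for
functions that are square integrable on `s`. -/
def IsWeakDeriv {X : Type*} [NormedAddCommGroup X] [NormedSpace ℝ X]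
    (s : Set ℝ) (u w : ℝ → X) : Prop :=
  ∀ ψ : ℝ → ℝ, IsTestFunction s ψ →
    ∫ t in s, deriv ψ t • u t = -∫ t in s, ψ t • w t

/-- The interval `I = (-L, L)`, where `L` may be infinite. -/
def I (L : ℝ≥0∞) : Set ℝ := {x : ℝ | ENNReal.ofReal |x| < L}

/-- The Hilbert space `H = L²(I)`. -/
abbrev H (L : ℝ≥0∞) : Type := Lp ℝ 2 (volume.restrict (I L))

/-- The Hilbert space `L²(I) × L²(I)`, with inner product `(u₁, v₁) + (u₂, v₂)`. -/
abbrev HH (L : ℝ≥0∞) : Type := WithLp 2 (H L × H L)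

theorem integrable_test_smul {L : ℝ≥0∞} {ψ : ℝ → ℝ} (h1 : Continuous ψ)
    (h2 : HasCompactSupport ψ) (u : H L) :
    Integrable (fun x => ψ x • u x) (volume.restrict (I L)) := by
  have hu : LocallyIntegrable (fun x => u x) (volume.restrict (I L)) :=
    (Lp.memLp u).locallyIntegrable (by norm_num)
  exact hu.integrable_smul_left_of_hasCompactSupport h1 h2

/-- The Sobolev space `H¹(I)`, as the space of all pairs `(u, u_x)` with `u ∈ L²(I)` and weak
derivative `u_x ∈ L²(I)`. Its inner product is `((u, v)) = (u, v) + (u_x, v_x)`. -/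
def sobolevH1 (L : ℝ≥0∞) : Submodule ℝ (HH L) where
  carrier := {p | IsWeakDeriv (I L) (fun x => p.fst x) (fun x => p.snd x)}
  zero_mem' := by
    intro ψ _
    have h0 : (fun x => (0 : H L) x) =ᵐ[volume.restrict (I L)] fun _ => (0 : ℝ) :=
      Lp.coeFn_zero ℝ 2 _
    have key : ∀ χ : ℝ → ℝ, ∫ x in I L, χ x • (0 : H L) x = 0 := by
      intro χ
      refine integral_eq_zero_of_ae ?_
      filter_upwards [h0] with x hx
      have hx' : (0 : H L) x = 0 := hx
      rw [hx', smul_zero, Pi.zero_apply]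
    change ∫ x in I L, deriv ψ x • (0 : H L) x = -∫ x in I L, ψ x • (0 : H L) x
    rw [key, key, neg_zero]
  add_mem' := by
    intro p q hp hq ψ hψ
    have key : ∀ (χ : ℝ → ℝ), Continuous χ → HasCompactSupport χ → ∀ u v : H L,
        ∫ x in I L, χ x • (u + v : H L) x
          = (∫ x in I L, χ x • u x) + ∫ x in I L, χ x • v x := by
      intro χ h1 h2 u v
      rw [← integral_add (integrable_test_smul h1 h2 u) (integrable_test_smul h1 h2 v)]
      refine integral_congr_ae ?_
      filter_upwards [Lp.coeFn_add u v] with x hx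
      rw [hx, Pi.add_apply, smul_add]
    have hd : Continuous (deriv ψ) := hψ.contDiff.continuous_deriv (by simp)
    have e1 := key (deriv ψ) hd hψ.hasCompactSupport.deriv p.fst q.fst
    have e2 := key ψ hψ.contDiff.continuous hψ.hasCompactSupport p.snd q.snd
    have e3 := hp ψ hψ
    have e4 := hq ψ hψ
    change ∫ x in I L, deriv ψ x • (p.fst + q.fst : H L) x
      = -∫ x in I L, ψ x • (p.snd + q.snd : H L) x
    rw [e1, e2, e3, e4, neg_add]
  smul_mem' := by
    intro c p hp ψ hψ
    have key : ∀ (χ : ℝ → ℝ) (u : H L),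
        ∫ x in I L, χ x • (c • u : H L) x = c • ∫ x in I L, χ x • u x := by
      intro χ u
      rw [← integral_smul]
      refine integral_congr_ae ?_
      filter_upwards [Lp.coeFn_smul c u] with x hx
      rw [hx, Pi.smul_apply, smul_comm]
    have e3 := hp ψ hψ
    change ∫ x in I L, deriv ψ x • (c • p.fst : H L) x
      = -∫ x in I L, ψ x • (c • p.snd : H L) x
    rw [key, key, e3, smul_neg]

/-- The Sobolev space `H¹₀(I)`: the closure of the test functions on `I` in the norm of `H¹`
(again a space of pairs `(u, u_x)`). -/
def sobolevH10 (L : ℝ≥0∞) : Submodule ℝ (HH L) :=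
  (Submodule.span ℝ {p : HH L | ∃ ψ : ℝ → ℝ, IsTestFunction (I L) ψ ∧
    (p.fst : ℝ → ℝ) =ᵐ[volume.restrict (I L)] ψ ∧
    (p.snd : ℝ → ℝ) =ᵐ[volume.restrict (I L)] deriv ψ}).topologicalClosure

/-- The two kinds of boundary conditions. -/
inductive BoundaryCondition
  | dirichlet
  | neumann

/-- The space `V`: `H¹₀(I)` for the Dirichlet condition, and `H¹(I)` for the Neumann condition,
which is the natural boundary condition of the form `a` on `H¹(I)`. -/
def energySpace (L : ℝ≥0∞) : BoundaryCondition → Submodule ℝ (HH L)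
  | .dirichlet => sobolevH10 L
  | .neumann => sobolevH1 L

/-- `V`, with the inner product `((u, v)) = (u, v) + (u_x, v_x)`. -/
abbrev V (L : ℝ≥0∞) (bc : BoundaryCondition) : Type := ↥(energySpace L bc)

instance (L : ℝ≥0∞) (bc : BoundaryCondition) : NormedAddCommGroup (V L bc) :=
  Submodule.normedAddCommGroup _

instance (L : ℝ≥0∞) (bc : BoundaryCondition) : InnerProductSpace ℝ (V L bc) :=
  Submodule.innerProductSpace _

instance (L : ℝ≥0∞) (bc : BoundaryCondition) : NormedSpace ℝ (V L bc) :=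
  Submodule.normedSpace _

/-- The dual space `V*`. -/
abbrev Vdual (L : ℝ≥0∞) (bc : BoundaryCondition) : Type := V L bc →L[ℝ] ℝ

/-- The embedding `V → H`, `u ↦ u`. -/
def toH (L : ℝ≥0∞) (bc : BoundaryCondition) : V L bc →L[ℝ] H L :=
  (WithLp.fstL 2 ℝ (H L) (H L)).comp (energySpace L bc).subtypeL

/-- The spatial derivative `V → H`, `u ↦ u_x`. -/
def derivX (L : ℝ≥0∞) (bc : BoundaryCondition) : V L bc →L[ℝ] H L :=
  (WithLp.sndL 2 ℝ (H L) (H L)).comp (energySpace L bc).subtypeL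

/-- The embedding `H → V*`, `h ↦ (v ↦ (h, v))`. -/
def toDual (L : ℝ≥0∞) (bc : BoundaryCondition) : H L →L[ℝ] Vdual L bc :=
  (innerSL ℝ : H L →L[ℝ] H L →L[ℝ] ℝ).bilinearComp (ContinuousLinearMap.id ℝ (H L)) (toH L bc)

/-- The operator `𝒜 : V → V*` of the form `a(u, v) = (u_x, v_x) + κ (u, v)`. Without
regularization, `κ = 0`. -/
def opA (L : ℝ≥0∞) (bc : BoundaryCondition) (κ : ℝ) : V L bc →L[ℝ] Vdual L bc :=
  (innerSL ℝ : H L →L[ℝ] H L →L[ℝ] ℝ).bilinearComp (derivX L bc) (derivX L bc)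
    + κ • (innerSL ℝ : H L →L[ℝ] H L →L[ℝ] ℝ).bilinearComp (toH L bc) (toH L bc)

/-- The domain `D(𝒜) = {v ∈ V | 𝒜 v ∈ H}`, as the space of all pairs `(v, 𝒜 v)`, with the graph
norm `(‖v‖² + |𝒜 v|²)^(1/2)`. -/
def domain (L : ℝ≥0∞) (bc : BoundaryCondition) (κ : ℝ) :
    Submodule ℝ (WithLp 2 (V L bc × H L)) :=
  LinearMap.ker (((opA L bc κ).comp (WithLp.fstL 2 ℝ (V L bc) (H L))
    - (toDual L bc).comp (WithLp.sndL 2 ℝ (V L bc) (H L))) :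
      WithLp 2 (V L bc × H L) →L[ℝ] Vdual L bc).toLinearMap

/-- `D(𝒜)`. -/
abbrev DA (L : ℝ≥0∞) (bc : BoundaryCondition) (κ : ℝ) : Type := ↥(domain L bc κ)

instance (L : ℝ≥0∞) (bc : BoundaryCondition) (κ : ℝ) : NormedAddCommGroup (DA L bc κ) :=
  Submodule.normedAddCommGroup _

instance (L : ℝ≥0∞) (bc : BoundaryCondition) (κ : ℝ) : NormedSpace ℝ (DA L bc κ) :=
  Submodule.normedSpace _

/-- The embedding `D(𝒜) → V`. -/
def toV (L : ℝ≥0∞) (bc : BoundaryCondition) (κ : ℝ) : DA L bc κ →L[ℝ] V L bc :=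
  (WithLp.fstL 2 ℝ (V L bc) (H L)).comp (domain L bc κ).subtypeL

theorem memLp_nonlinearity {L : ℝ≥0∞} (ε : ℝ) {φ : ℝ → ℝ → ℝ}
    (hφ : Measurable (Function.uncurry φ)) (t : ℝ) (u : H L) :
    MemLp (fun x => ε⁻¹ * (Real.sin (φ x t) - Real.sin (φ x t + ε * u x))) 2
      (volume.restrict (I L)) := by
  have hm : Measurable fun x => φ x t := hφ.comp (measurable_id.prodMk measurable_const)
  have hu := (Lp.stronglyMeasurable u).measurable
  refine (Lp.memLp u).of_le (Measurable.aestronglyMeasurable (by fun_prop)) (ae_of_all _ ?_)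
  intro x
  have h1 : |Real.sin (φ x t) - Real.sin (φ x t + ε * u x)| ≤ |ε * u x| := by
    have := Real.abs_sin_sub_sin_le (φ x t) (φ x t + ε * u x)
    simpa [abs_neg] using this
  rw [norm_mul, Real.norm_eq_abs, Real.norm_eq_abs, Real.norm_eq_abs]
  by_cases hε : ε = 0
  · simp [hε]
  calc |ε⁻¹| * |Real.sin (φ x t) - Real.sin (φ x t + ε * u x)|
      ≤ |ε⁻¹| * |ε * u x| := by gcongr
    _ = |u x| := by rw [← abs_mul, inv_mul_cancel_left₀ hε]

/-- The map `f(t, ·) : H → H`,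
`f(t, u)(x) = ε⁻¹ (sin φ(x, t) - sin (φ(x, t) + ε u(x))) + g(x, t)`. -/
def forcing {L : ℝ≥0∞} (ε : ℝ) (φ : ℝ → ℝ → ℝ) (hφ : Measurable (Function.uncurry φ))
    (g : ℝ → H L) (t : ℝ) (u : H L) : H L :=
  (memLp_nonlinearity ε hφ t u).toLp
    (fun x => ε⁻¹ * (Real.sin (φ x t) - Real.sin (φ x t + ε * u x))) + g t

/-- `u ∈ L²(0, T; X)`. -/
def MemL2 {X : Type*} [NormedAddCommGroup X] (T : ℝ) (u : ℝ → X) : Prop :=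
  MemLp u 2 (volume.restrict (Ioo 0 T))

/-- `u ∈ L²(0, T; X)` for a function `u` with values in `Y`, where `X` embeds into `Y` by `j`. -/
def MemL2In {X Y : Type*} [NormedAddCommGroup X] [NormedSpace ℝ X] [NormedAddCommGroup Y]
    [NormedSpace ℝ Y] (T : ℝ) (j : X →L[ℝ] Y) (u : ℝ → Y) : Prop :=
  ∃ w : ℝ → X, MemL2 T w ∧ ∀ᵐ t ∂(volume.restrict (Ioo 0 T)), j (w t) = u t

/-- `u ∈ C([0, T]; X)`, after modification on a null set, for a function `u` with values in `Y`,
where `X` embeds into `Y` by `j`. -/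
def MemCIn {X Y : Type*} [NormedAddCommGroup X] [NormedSpace ℝ X] [NormedAddCommGroup Y]
    [NormedSpace ℝ Y] (T : ℝ) (j : X →L[ℝ] Y) (u : ℝ → Y) : Prop :=
  ∃ w : ℝ → X, ContinuousOn w (Icc 0 T) ∧ ∀ᵐ t ∂(volume.restrict (Ioo 0 T)), j (w t) = u t

/-- The function `u`, defined almost everywhere on `(0, T)`, has a continuous representative
on `[0, T]`, and the value of this representative at `0` is `y`. -/
def HasInitialValue {Y : Type*} [NormedAddCommGroup Y] (T : ℝ) (u : ℝ → Y) (y : Y) : Prop :=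
  ∃ w : ℝ → Y, ContinuousOn w (Icc 0 T) ∧ (∀ᵐ t ∂(volume.restrict (Ioo 0 T)), w t = u t) ∧
    w 0 = y

/-- `η` is a weak solution on `(0, T)` of `η'' + 𝒜 η = F(t, η)`, `η(0) = u₀`, `η'(0) = v₀`, with
distributional time derivatives `η' = η₁` and `η'' = η₂`. The equation holds in `V*` for almost
every `t`. A function with `η ∈ L²(0, T; V)`, `η' ∈ L²(0, T; H)`, `η'' ∈ L²(0, T; V*)` has
representatives `η ∈ C([0, T]; H)` and `η' ∈ C([0, T]; V*)`; the initial values are those of these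
representatives. -/
structure IsWeakSolution (L : ℝ≥0∞) (bc : BoundaryCondition) (κ T : ℝ) (F : ℝ → H L → H L)
    (u₀ : V L bc) (v₀ : H L)
    (η : ℝ → V L bc) (η₁ : ℝ → H L) (η₂ : ℝ → Vdual L bc) : Prop where
  memL2 : MemL2 T η
  memL2_deriv : MemL2 T η₁
  memL2_deriv2 : MemL2 T η₂
  weakDeriv : IsWeakDeriv (Ioo 0 T) (fun t => toH L bc (η t)) η₁
  weakDeriv2 : IsWeakDeriv (Ioo 0 T) (fun t => toDual L bc (η₁ t)) η₂
  equation : ∀ᵐ t ∂(volume.restrict (Ioo 0 T)),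
    η₂ t + opA L bc κ (η t) = toDual L bc (F t (toH L bc (η t)))
  init : HasInitialValue T (fun t => toH L bc (η t)) (toH L bc u₀)
  init_deriv : HasInitialValue T (fun t => toDual L bc (η₁ t)) (toDual L bc v₀)

end SineGordon

end

/-! Let `j : V → H` be the embedding and `K : H → V` its adjoint. The Riesz isomorphism `V* ≅ V`
turns `H → V*` into `K` and `𝒜` into `1 + (κ - 1) K j`. The equation becomes `(K j η)'' + η = K j G`
with `G = f(t, η) + (1 - κ) η` in `L²(0, T; V)`, so only bounded operators remain. Since `D(𝒜)` is
the range of `K`, the claim is that `η = K h` with `h` continuous into `H` and `η' = j w` with `w`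
continuous into `V`; then `η'' = f - 𝒜 η` takes values in `H`.

Formally `‖w‖² + |h|²` changes only through the work of `G`, but `η` is not known to be regular
enough for this computation. Put `S = K j` and let `A_n = n² (1 + n S)⁻²`, a bounded substitute for
`S⁻²`. Then `θ = A_n K j η` and `p = K j θ'` satisfy `p' = Y_n G - θ`, where `Y_n = S A_n S`
converges strongly to the projection off `ker S` (`tendsto_yosidaSq`). The energy `‖p‖² + |j θ|²` is
now legitimate, by `norm_sq_eq_add_integral_inner` and `IsWeakDeriv.eq_add_integral`. Applying
`energy_bound` to `A_n - A_m` shows that `j A_n K j η` and `K j A_n K η'` are uniformly Cauchy;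
their limits are `h` and `w` (`abstract_regularity`). Neither injectivity nor density of the
embedding is needed, because the equation itself removes the kernel components. -/

/-! ### Energy identity for primitives with values in a Hilbert space -/

theorem AbsolutelyContinuousOnInterval.of_dist_le {X Y : Type*} [PseudoMetricSpace X]
    [PseudoMetricSpace Y] {f : ℝ → X} {g : ℝ → Y} {a b : ℝ}
    (hg : AbsolutelyContinuousOnInterval g a b)
    (h : ∀ x ∈ uIcc a b, ∀ y ∈ uIcc a b, dist (f x) (f y) ≤ dist (g x) (g y)) :
    AbsolutelyContinuousOnInterval f a b := by
  rw [absolutelyContinuousOnInterval_iff] at hg ⊢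
  intro ε hε
  obtain ⟨δ, hδ, H⟩ := hg ε hε
  refine ⟨δ, hδ, fun E hE hlt => lt_of_le_of_lt (Finset.sum_le_sum fun i hi => ?_) (H E hE hlt)⟩
  have hm := hE.1 i hi
  exact h _ hm.1 _ hm.2

/-- Both sides are absolutely continuous and, by Lebesgue differentiation, have the same derivative
almost everywhere, so their difference is constant. -/
theorem norm_sq_eq_add_integral_inner {X : Type*} [NormedAddCommGroup X] [InnerProductSpace ℝ X]
    [CompleteSpace X] {T : ℝ} (hT : 0 ≤ T) {x x' : ℝ → X}
    (hx' : IntervalIntegrable x' volume 0 T)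
    (hx : ∀ t ∈ Icc 0 T, x t = x 0 + ∫ s in (0 : ℝ)..t, x' s) :
    IntervalIntegrable (fun s => inner ℝ (x s) (x' s)) volume 0 T ∧
    ∀ t ∈ Icc 0 T, ‖x t‖ ^ 2 = ‖x 0‖ ^ 2 + ∫ s in (0 : ℝ)..t, 2 * inner ℝ (x s) (x' s) := by
  have hu : uIcc 0 T = Icc 0 T := uIcc_of_le hT
  have h0 : (0 : ℝ) ∈ Icc 0 T := ⟨le_rfl, hT⟩
  have hcont : ContinuousOn x (Icc 0 T) := by
    have : ContinuousOn (fun t => x 0 + ∫ s in (0 : ℝ)..t, x' s) (Icc 0 T) := by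
      rw [← hu]
      exact continuousOn_const.add
        (intervalIntegral.continuousOn_primitive_interval' hx' left_mem_uIcc)
    exact this.congr hx
  obtain ⟨M, hM⟩ := isCompact_Icc.exists_bound_of_continuousOn hcont
  have hM0 : 0 ≤ M := (norm_nonneg _).trans (hM 0 h0)
  have hmeas : AEStronglyMeasurable (fun s => inner ℝ (x s) (x' s))
      (volume.restrict (uIoc 0 T)) := by
    refine AEStronglyMeasurable.inner ?_ hx'.aestronglyMeasurable_restrict_uIoc
    rw [uIoc_of_le hT]
    exact (hcont.mono Ioc_subset_Icc_self).aestronglyMeasurable measurableSet_Ioc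
  have hint : IntervalIntegrable (fun s => inner ℝ (x s) (x' s)) volume 0 T := by
    refine (hx'.norm.const_mul M).mono_fun hmeas ?_
    refine (ae_restrict_iff' measurableSet_uIoc).2 (ae_of_all _ fun s hs => ?_)
    rw [uIoc_of_le hT] at hs
    refine (norm_inner_le_norm _ _).trans ?_
    simp only
    rw [Real.norm_of_nonneg (mul_nonneg hM0 (norm_nonneg _))]
    exact mul_le_mul_of_nonneg_right (hM s (Ioc_subset_Icc_self hs)) (norm_nonneg _)
  refine ⟨hint, ?_⟩
  have hint2 := hint.const_mul 2
  have hac1 : AbsolutelyContinuousOnInterval (fun t => ‖x t‖ ^ 2) 0 T := by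
    -- The majorant is `2M ∫ ‖x'‖`, since `‖x s‖ + ‖x t‖ ≤ 2M`.
    have hv := ((hx'.norm.const_mul (2 * M)).absolutelyContinuousOnInterval_intervalIntegral
      (c := 0) left_mem_uIcc)
    refine hv.of_dist_le fun s hs t ht => ?_
    have hs0 : uIcc 0 s ⊆ uIcc 0 T := uIcc_subset_uIcc left_mem_uIcc hs
    have ht0 : uIcc 0 t ⊆ uIcc 0 T := uIcc_subset_uIcc left_mem_uIcc ht
    have hn := hx'.norm.const_mul (2 * M)
    rw [Real.dist_eq, Real.dist_eq,
      intervalIntegral.integral_interval_sub_left (hn.mono_set hs0) (hn.mono_set ht0),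
      intervalIntegral.integral_const_mul, abs_mul, abs_of_nonneg (by positivity : 0 ≤ 2 * M)]
    rw [hu] at hs ht
    have e : x s - x t = ∫ r in t..s, x' r := by
      rw [hx s hs, hx t ht, add_sub_add_left_eq_sub]
      exact intervalIntegral.integral_interval_sub_left (hx'.mono_set hs0) (hx'.mono_set ht0)
    have e1 : ‖x s - x t‖ ≤ |∫ r in t..s, ‖x' r‖| := by
      rw [e]; exact intervalIntegral.norm_integral_le_abs_integral_norm
    have e2 : ‖x s‖ ^ 2 - ‖x t‖ ^ 2 = (‖x s‖ + ‖x t‖) * (‖x s‖ - ‖x t‖) := by ring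
    rw [e2, abs_mul]
    refine mul_le_mul ?_ ((abs_norm_sub_norm_le _ _).trans e1) (abs_nonneg _) (by positivity)
    rw [abs_of_nonneg (by positivity)]
    linarith [hM s hs, hM t ht]
  have hac2 := hac1.sub (hint2.absolutelyContinuousOnInterval_intervalIntegral
      (c := 0) left_mem_uIcc)
  obtain ⟨C, hC⟩ := hac2.const_of_ae_hasDerivAt_zero (by
    -- The formula for `x` holds only on `[0, T]`, so a two-sided derivative is available only in
    -- the interior.
    have hne : ∀ᵐ s : ℝ, s ≠ 0 ∧ s ≠ T := by
      have h1 : ∀ᵐ s : ℝ, s ≠ 0 := by simp [ae_iff]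
      have h2 : ∀ᵐ s : ℝ, s ≠ T := by simp [ae_iff]
      exact h1.and h2
    filter_upwards [hx'.ae_hasDerivAt_integral, hint2.ae_hasDerivAt_integral, hne]
      with s h1 h2 h3 hs
    have hs' := hs
    rw [hu] at hs'
    have hnhds : Icc 0 T ∈ 𝓝 s :=
      Icc_mem_nhds (lt_of_le_of_ne hs'.1 h3.1.symm) (lt_of_le_of_ne hs'.2 h3.2)
    have d1 : HasDerivAt x (x' s) s := by
      refine ((h1 hs 0 left_mem_uIcc).const_add (x 0)).congr_of_eventuallyEq ?_
      filter_upwards [hnhds] with r hr using hx r hr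
    have d2 := d1.norm_sq
    have := d2.sub (h2 hs 0 left_mem_uIcc)
    rwa [sub_self] at this)
  intro t ht
  have c0 := hC 0 left_mem_uIcc
  have ct := hC t (hu ▸ ht)
  simp only [Pi.sub_apply, intervalIntegral.integral_same, sub_zero] at c0 ct
  rw [c0]
  linarith

namespace SineGordon

/-! ### Weak time derivatives and primitives -/

theorem integrable_deriv_smoothTransition : Integrable (deriv Real.smoothTransition) := by
  have hc : Continuous (deriv Real.smoothTransition) :=
    (Real.smoothTransition.contDiff (n := 1)).continuous_deriv (by simp)
  refine hc.integrable_of_hasCompactSupport ?_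
  refine HasCompactSupport.intro (K := Icc 0 1) isCompact_Icc fun x hx => ?_
  have : x < 0 ∨ 1 < x := by
    by_contra! h
    exact hx h
  rcases this with h | h
  · have : Real.smoothTransition =ᶠ[𝓝 x] fun _ => 0 := by
      filter_upwards [gt_mem_nhds h] with y hy using Real.smoothTransition.zero_of_nonpos hy.le
    rw [this.deriv_eq, deriv_const]
  · have : Real.smoothTransition =ᶠ[𝓝 x] fun _ => 1 := by
      filter_upwards [lt_mem_nhds h] with y hy using Real.smoothTransition.one_of_one_le hy.le
    rw [this.deriv_eq, deriv_const]

theorem integral_deriv_smoothTransition : ∫ y, deriv Real.smoothTransition y = 1 := by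
  have := integral_of_hasDerivAt_of_tendsto (f := Real.smoothTransition) (m := 0) (n := 1)
    (fun x => ((Real.smoothTransition.contDiff (n := 1)).differentiable (by simp) x).hasDerivAt)
    integrable_deriv_smoothTransition
    (tendsto_const_nhds.congr' (by
      filter_upwards [eventually_le_atBot 0] with y hy
      exact (Real.smoothTransition.zero_of_nonpos hy).symm))
    (tendsto_const_nhds.congr' (by
      filter_upwards [eventually_ge_atTop 1] with y hy
      exact (Real.smoothTransition.one_of_one_le hy).symm))
  rw [this, sub_zero]

/-- The rescaled bumps form an approximate identity at `a`. Substituting `y = n (x - a)` moves `n`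
into the argument of the bounded function `U`, where dominated convergence applies. -/
theorem tendsto_integral_deriv_smoothTransition {X : Type*} [NormedAddCommGroup X]
    [NormedSpace ℝ X] [CompleteSpace X] {U : ℝ → X} (hU : Continuous U) {C : ℝ}
    (hC : ∀ x, ‖U x‖ ≤ C) (a : ℝ) :
    Tendsto (fun n : ℕ => ∫ x, ((n : ℝ) * deriv Real.smoothTransition (n * (x - a))) • U x)
      atTop (𝓝 (U a)) := by
  have hlim : Tendsto (fun n : ℕ => ∫ y, deriv Real.smoothTransition y • U (y / n + a))
      atTop (𝓝 (∫ y, deriv Real.smoothTransition y • U a)) := by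
    refine tendsto_integral_of_dominated_convergence
      (fun y => ‖deriv Real.smoothTransition y‖ * C) ?_ ?_ ?_ ?_
    · intro n
      have hc : Continuous (deriv Real.smoothTransition) :=
        (Real.smoothTransition.contDiff (n := 1)).continuous_deriv (by simp)
      exact (hc.smul (hU.comp (by fun_prop))).aestronglyMeasurable
    · exact integrable_deriv_smoothTransition.norm.mul_const C
    · intro n
      refine ae_of_all _ fun y => ?_
      rw [norm_smul]
      exact mul_le_mul_of_nonneg_left (hC _) (norm_nonneg _)
    · refine ae_of_all _ fun y => Tendsto.const_smul ?_ _
      have : Tendsto (fun n : ℕ => y / (n : ℝ) + a) atTop (𝓝 (0 + a)) :=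
        (tendsto_const_div_atTop_nhds_zero_nat y).add_const a
      rw [zero_add] at this
      exact (hU.tendsto a).comp this
  rw [integral_smul_const, integral_deriv_smoothTransition, one_smul] at hlim
  refine hlim.congr' ?_
  filter_upwards [eventually_gt_atTop 0] with n hn
  have hn' : (0 : ℝ) < n := by exact_mod_cast hn
  have e1 := Measure.integral_comp_mul_left
    (fun y => deriv Real.smoothTransition y • U (y / n + a)) (n : ℝ)
  have e2 := integral_sub_right_eq_self (μ := volume)
    (fun y : ℝ => deriv Real.smoothTransition (n * y) • U (n * y / n + a)) a
  rw [abs_of_pos (inv_pos.2 hn')] at e1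
  have e3 := e2.trans e1
  rw [eq_comm, inv_smul_eq_iff₀ hn'.ne'] at e3
  rw [e3, ← integral_smul]
  refine integral_congr_ae (ae_of_all _ fun x => ?_)
  simp only
  rw [smul_smul, mul_div_cancel_left₀ _ hn'.ne', sub_add_cancel]

theorem tendsto_smoothTransition_mul (a x : ℝ) :
    Tendsto (fun n : ℕ => Real.smoothTransition (n * (x - a))) atTop
      (𝓝 ((Ioi a).indicator (fun _ => 1) x)) := by
  by_cases h : a < x
  · rw [indicator_of_mem (mem_Ioi.2 h)]
    refine tendsto_const_nhds.congr' ?_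
    have : Tendsto (fun n : ℕ => (n : ℝ) * (x - a)) atTop atTop :=
      tendsto_natCast_atTop_atTop.atTop_mul_const (sub_pos.2 h)
    filter_upwards [this.eventually_ge_atTop 1] with n hn
    exact (Real.smoothTransition.one_of_one_le hn).symm
  · rw [indicator_of_notMem (by simpa using h)]
    refine tendsto_const_nhds.congr fun n => ?_
    push Not at h
    exact (Real.smoothTransition.zero_of_nonpos
      (mul_nonpos_of_nonneg_of_nonpos n.cast_nonneg (sub_nonpos.2 h))).symm

theorem isTestFunction_smoothTransition_sub {T a b : ℝ} (ha : 0 < a) (hab : a ≤ b)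
    {n : ℕ} (hn : 0 < n) (hb : b + 1 / n < T) :
    IsTestFunction (Ioo 0 T) (fun x => Real.smoothTransition (n * (x - a))
      - Real.smoothTransition (n * (x - b))) := by
  have hn' : (0 : ℝ) < n := by exact_mod_cast hn
  have hz : ∀ x ∉ Icc a (b + 1 / n), Real.smoothTransition (n * (x - a))
      - Real.smoothTransition (n * (x - b)) = 0 := by
    intro x hx
    have : x < a ∨ b + 1 / n < x := by
      by_contra! h
      exact hx h
    rcases this with h | h
    · rw [Real.smoothTransition.zero_of_nonpos (by nlinarith),
        Real.smoothTransition.zero_of_nonpos (by nlinarith), sub_zero]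
    · have h1 : 1 ≤ n * (x - b) := by
        have : n * (1 / (n : ℝ)) = 1 := by field_simp
        nlinarith
      rw [Real.smoothTransition.one_of_one_le h1,
        Real.smoothTransition.one_of_one_le (by nlinarith), sub_self]
  have hts : tsupport (fun x => Real.smoothTransition (n * (x - a))
      - Real.smoothTransition (n * (x - b))) ⊆ Icc a (b + 1 / n) := by
    refine closure_minimal (fun x hx => ?_) isClosed_Icc
    by_contra h
    exact hx (hz x h)
  refine ⟨?_, HasCompactSupport.intro isCompact_Icc hz, hts.trans fun x hx => ?_⟩
  · have h : ContDiff ℝ ∞ Real.smoothTransition := Real.smoothTransition.contDiff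
    exact (h.comp (by fun_prop)).sub (h.comp (by fun_prop))
  · exact ⟨ha.trans_le hx.1, hx.2.trans_lt hb⟩

theorem deriv_smoothTransition_sub (n : ℕ) (a b x : ℝ) :
    deriv (fun x => Real.smoothTransition (n * (x - a)) - Real.smoothTransition (n * (x - b))) x
      = n * deriv Real.smoothTransition (n * (x - a))
        - n * deriv Real.smoothTransition (n * (x - b)) := by
  have h : ∀ c : ℝ, HasDerivAt (fun x : ℝ => Real.smoothTransition (n * (x - c)))
      (n * deriv Real.smoothTransition (n * (x - c))) x := by
    intro c
    have h1 : HasDerivAt Real.smoothTransition (deriv Real.smoothTransition (n * (x - c)))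
        (n * (x - c)) :=
      ((Real.smoothTransition.contDiff (n := 1)).differentiable (by simp) _).hasDerivAt
    have h2 : HasDerivAt (fun x : ℝ => (n : ℝ) * (x - c)) n x := by
      simpa using ((hasDerivAt_id x).sub_const c).const_mul (n : ℝ)
    rw [mul_comm]
    exact h1.comp x h2
  exact ((h a).sub (h b)).deriv

/-- Test with smooth approximations of the indicator of `(a, b]`: their derivatives concentrate with
mass `1` at `a` and `-1` at `b`. -/
theorem IsWeakDeriv.sub_eq_integral {X : Type*} [NormedAddCommGroup X] [NormedSpace ℝ X]
    [CompleteSpace X] {T : ℝ} {u w U : ℝ → X} (hu : IsWeakDeriv (Ioo 0 T) u w)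
    (hw : IntegrableOn w (Ioo 0 T)) (hU : ContinuousOn U (Icc 0 T))
    (hUu : ∀ᵐ t ∂(volume.restrict (Ioo 0 T)), U t = u t) {a b : ℝ} (ha : 0 < a) (hab : a ≤ b)
    (hb : b < T) : U b - U a = ∫ s in a..b, w s := by
  have hT : 0 ≤ T := (ha.le.trans hab).trans hb.le
  -- The extension by the end values is continuous and bounded on all of `ℝ`, as the approximate
  -- identity requires.
  set E : ℝ → X := IccExtend hT ((Icc 0 T).domRestrict U) with hE
  have hEc : Continuous E := (continuousOn_iff_continuous_domRestrict.1 hU).Icc_extend'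
  have hEU : ∀ x ∈ Icc 0 T, E x = U x := fun x hx => IccExtend_of_mem hT _ hx
  obtain ⟨C, hC⟩ := isCompact_Icc.exists_bound_of_continuousOn hU
  have hEC : ∀ x, ‖E x‖ ≤ C := fun x => hC _ (Subtype.mem _)
  set ψ : ℕ → ℝ → ℝ := fun n x => Real.smoothTransition (n * (x - a))
    - Real.smoothTransition (n * (x - b)) with hψ
  have hev : ∀ᶠ n : ℕ in atTop, IsTestFunction (Ioo 0 T) (ψ n) := by
    have : Tendsto (fun n : ℕ => b + 1 / (n : ℝ)) atTop (𝓝 (b + 0)) :=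
      tendsto_one_div_atTop_nhds_zero_nat.const_add b
    rw [add_zero] at this
    filter_upwards [this.eventually_lt_const hb, eventually_gt_atTop 0] with n h1 h2
    exact isTestFunction_smoothTransition_sub ha hab h2 h1
  have hi : ∀ᶠ n : ℕ in atTop, ∀ c, Integrable
      (fun x => ((n : ℝ) * deriv Real.smoothTransition (n * (x - c))) • E x) := by
    filter_upwards [eventually_gt_atTop 0] with n hn c
    have hn' : (n : ℝ) ≠ 0 := by exact_mod_cast hn.ne'
    have h1 : Integrable (fun x => deriv Real.smoothTransition (n * (x - c))) :=
      (integrable_deriv_smoothTransition.comp_mul_left' hn').comp_sub_right c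
    exact (h1.const_mul (n : ℝ)).smul_bdd C hEc.aestronglyMeasurable (ae_of_all _ hEC)
  have hlim1 : Tendsto (fun n : ℕ => ∫ x in Ioo 0 T, deriv (ψ n) x • u x) atTop
      (𝓝 (U a - U b)) := by
    have h := (tendsto_integral_deriv_smoothTransition hEc hEC a).sub
      (tendsto_integral_deriv_smoothTransition hEc hEC b)
    rw [hEU a ⟨ha.le, hab.trans hb.le⟩, hEU b ⟨ha.le.trans hab, hb.le⟩] at h
    refine h.congr' ?_
    filter_upwards [hev, hi] with n h1 h2
    rw [← integral_sub (h2 a) (h2 b)]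
    have e1 : ∫ x in Ioo 0 T, deriv (ψ n) x • u x = ∫ x in Ioo 0 T, deriv (ψ n) x • E x := by
      refine integral_congr_ae ?_
      filter_upwards [hUu, ae_restrict_mem measurableSet_Ioo] with x hx hx'
      rw [hEU x (Ioo_subset_Icc_self hx'), hx]
    rw [e1, setIntegral_eq_integral_of_forall_compl_eq_zero]
    · refine integral_congr_ae (ae_of_all _ fun x => ?_)
      simp only
      rw [← sub_smul, deriv_smoothTransition_sub]
    · intro x hx
      have : deriv (ψ n) x = 0 := by
        by_contra h
        exact hx (h1.tsupport_subset (support_deriv_subset h))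
      rw [this, zero_smul]
  have hlim2 : Tendsto (fun n : ℕ => ∫ x in Ioo 0 T, ψ n x • w x) atTop
      (𝓝 (∫ s in a..b, w s)) := by
    have hsub : Ioc a b ⊆ Ioo 0 T := fun x hx => ⟨ha.trans hx.1, hx.2.trans_lt hb⟩
    have : ∫ s in a..b, w s = ∫ x in Ioo 0 T, (Ioc a b).indicator w x := by
      rw [intervalIntegral.integral_of_le hab, setIntegral_indicator measurableSet_Ioc,
        inter_eq_right.2 hsub]
    rw [this]
    refine tendsto_integral_of_dominated_convergence (fun x => ‖w x‖) ?_ hw.norm ?_ ?_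
    · intro n
      have hc : Continuous (ψ n) := by
        have := Real.smoothTransition.continuous
        exact (this.comp (by fun_prop)).sub (this.comp (by fun_prop))
      exact hc.aestronglyMeasurable.smul hw.aestronglyMeasurable
    · intro n
      refine ae_of_all _ fun x => ?_
      rw [norm_smul]
      refine mul_le_of_le_one_left (norm_nonneg _) ?_
      rw [Real.norm_eq_abs, abs_le]
      constructor <;> simp only [hψ] <;>
      linarith [Real.smoothTransition.nonneg (n * (x - a)),
        Real.smoothTransition.nonneg (n * (x - b)), Real.smoothTransition.le_one (n * (x - a)),
        Real.smoothTransition.le_one (n * (x - b))]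
    · refine ae_of_all _ fun x => ?_
      have h := ((tendsto_smoothTransition_mul a x).sub (tendsto_smoothTransition_mul b x)).smul_const
        (w x)
      convert h using 2
      by_cases h1 : a < x
      · by_cases h2 : b < x
        · simp [indicator, h1, h2]
        · push Not at h2
          simp [indicator, h1, h2, not_lt.2 h2]
      · have h2 : x ≤ b := (not_lt.1 h1).trans hab
        simp [indicator, h1, not_lt.2 h2]
  have := tendsto_nhds_unique hlim1 (hlim2.neg.congr' (by
    filter_upwards [hev] with n hn using (hu _ hn).symm))
  rw [← neg_sub, this, neg_neg]

/-- The continuous representative of a function with an integrable weak derivative is a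
primitive of this derivative. -/
theorem IsWeakDeriv.eq_add_integral {X : Type*} [NormedAddCommGroup X] [NormedSpace ℝ X]
    [CompleteSpace X] {T : ℝ} (hT : 0 < T) {u w U : ℝ → X} (hu : IsWeakDeriv (Ioo 0 T) u w)
    (hw : IntervalIntegrable w volume 0 T) (hU : ContinuousOn U (Icc 0 T))
    (hUu : ∀ᵐ t ∂(volume.restrict (Ioo 0 T)), U t = u t) :
    ∀ t ∈ Icc 0 T, U t = U 0 + ∫ s in (0 : ℝ)..t, w s := by
  have hwI : IntegrableOn w (Ioo 0 T) := (intervalIntegrable_iff_integrableOn_Ioo_of_le hT.le).1 hw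
  have hmid : T / 2 ∈ Ioo 0 T := ⟨by linarith, by linarith⟩
  -- Compactly supported test functions only see the open interval: `Z` is constant there, and
  -- continuity carries this to the endpoints.
  set Z : ℝ → X := fun t => U t - ∫ s in (0 : ℝ)..t, w s with hZ
  have hZc : ContinuousOn Z (Icc 0 T) := by
    refine hU.sub ?_
    rw [← uIcc_of_le hT.le]
    exact intervalIntegral.continuousOn_primitive_interval' hw left_mem_uIcc
  have hsub : ∀ c ∈ Ioo 0 T, IntervalIntegrable w volume 0 c := fun c hc =>
    hw.mono_set (uIcc_subset_uIcc left_mem_uIcc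
      (by rw [uIcc_of_le hT.le]; exact Ioo_subset_Icc_self hc))
  have key : ∀ a ∈ Ioo 0 T, ∀ b ∈ Ioo 0 T, a ≤ b → Z b = Z a := by
    intro a ha b hb hab
    have h := hu.sub_eq_integral hwI hU hUu ha.1 hab hb.2
    rw [← intervalIntegral.integral_interval_sub_left (hsub b hb) (hsub a ha)] at h
    simp only [hZ]
    rw [sub_eq_sub_iff_sub_eq_sub, h]
  have hconst : EqOn Z (fun _ => Z (T / 2)) (Ioo 0 T) := by
    intro t ht
    rcases le_total t (T / 2) with h | h
    · exact (key t ht _ hmid h).symm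
    · exact key _ hmid t ht h
  have hall : EqOn Z (fun _ => Z (T / 2)) (Icc 0 T) :=
    hconst.of_subset_closure hZc continuousOn_const Ioo_subset_Icc_self
      (by rw [closure_Ioo hT.ne])
  intro t ht
  have h1 := (hall ht).trans (hall ⟨le_rfl, hT.le⟩).symm
  simp only [hZ, intervalIntegral.integral_same, sub_zero] at h1
  rw [← h1, sub_add_cancel]

theorem IsWeakDeriv.comp_clm {X Y : Type*} [NormedAddCommGroup X] [NormedSpace ℝ X]
    [CompleteSpace X] [NormedAddCommGroup Y] [NormedSpace ℝ Y] [CompleteSpace Y]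
    {T : ℝ} {u w : ℝ → X} (hu : IsWeakDeriv (Ioo 0 T) u w)
    (hui : IntegrableOn u (Ioo 0 T)) (hwi : IntegrableOn w (Ioo 0 T)) (B : X →L[ℝ] Y) :
    IsWeakDeriv (Ioo 0 T) (fun t => B (u t)) (fun t => B (w t)) := by
  have key : ∀ (χ : ℝ → ℝ), Continuous χ → HasCompactSupport χ → ∀ v : ℝ → X,
      IntegrableOn v (Ioo 0 T) → ∫ t in Ioo 0 T, χ t • B (v t) = B (∫ t in Ioo 0 T, χ t • v t) := by
    intro χ h1 h2 v hv
    obtain ⟨C, hC⟩ := h2.exists_bound_of_continuous h1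
    have hi : Integrable (fun t => χ t • v t) (volume.restrict (Ioo 0 T)) :=
      hv.bdd_smul C h1.aestronglyMeasurable (ae_of_all _ hC)
    rw [← B.integral_comp_comm hi]
    simp
  intro ψ hψ
  have hd : Continuous (deriv ψ) := hψ.contDiff.continuous_deriv (by simp)
  rw [key _ hd hψ.hasCompactSupport.deriv u hui,
    key ψ hψ.contDiff.continuous hψ.hasCompactSupport w hwi, hu ψ hψ, map_neg]

theorem IsWeakDeriv.ae_eq_zero {X : Type*} [NormedAddCommGroup X] [NormedSpace ℝ X]
    [CompleteSpace X] {T : ℝ} {u w : ℝ → X} (hu : IsWeakDeriv (Ioo 0 T) u w)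
    (hwi : IntegrableOn w (Ioo 0 T)) (h0 : ∀ᵐ t ∂(volume.restrict (Ioo 0 T)), u t = 0) :
    ∀ᵐ t ∂(volume.restrict (Ioo 0 T)), w t = 0 := by
  rw [ae_restrict_iff' measurableSet_Ioo]
  refine isOpen_Ioo.ae_eq_zero_of_integral_contDiff_smul_eq_zero hwi.locallyIntegrableOn ?_
  intro ψ h1 h2 h3
  have h := hu ψ ⟨h1, h2, h3⟩
  have e : ∫ t in Ioo 0 T, deriv ψ t • u t = 0 := by
    refine integral_eq_zero_of_ae ?_
    filter_upwards [h0] with t ht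
    rw [ht, smul_zero, Pi.zero_apply]
  rw [e, zero_eq_neg, setIntegral_eq_integral_of_forall_compl_eq_zero] at h
  · exact h
  · intro t ht
    rw [image_eq_zero_of_notMem_tsupport fun h => ht (h3 h), zero_smul]

/-! ### Yosida regularization of a nonnegative bounded operator -/

section Resolvent

variable {X : Type*} [NormedAddCommGroup X] [InnerProductSpace ℝ X]

/-- The resolvent `(1 + n S)⁻¹`. -/
noncomputable def resolvent (S : X →L[ℝ] X) (n : ℕ) : X →L[ℝ] X :=
  Ring.inverse (1 + (n : ℝ) • S)

/-- The Yosida regularization `n S (1 + n S)⁻¹ = 1 - (1 + n S)⁻¹` of the identity, squared. -/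
noncomputable def yosidaSq (S : X →L[ℝ] X) (n : ℕ) : X →L[ℝ] X :=
  (1 - resolvent S n) * (1 - resolvent S n)

variable [CompleteSpace X] {S : X →L[ℝ] X}

/-- Coercivity with constant `1`: the form of `1 + n S` dominates `‖x‖²`. -/
theorem isUnit_one_add_smul (hS : ∀ x, 0 ≤ inner ℝ (S x) x) (n : ℕ) :
    IsUnit (1 + (n : ℝ) • S) := by
  refine ContinuousLinearMap.isUnit_of_forall_le_norm_inner_map _ (c := 1) one_pos fun x => ?_
  have h : inner ℝ ((1 + (n : ℝ) • S) x) x = ‖x‖ ^ 2 + n * inner ℝ (S x) x := by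
    simp [inner_add_left, inner_smul_left]
  have h2 : 0 ≤ n * inner ℝ (S x) x := mul_nonneg n.cast_nonneg (hS x)
  rw [h, Real.norm_of_nonneg (by positivity)]
  simp [h2]

theorem one_add_smul_mul_resolvent (hS : ∀ x, 0 ≤ inner ℝ (S x) x) (n : ℕ) :
    (1 + (n : ℝ) • S) * resolvent S n = 1 :=
  Ring.mul_inverse_cancel _ (isUnit_one_add_smul hS n)

theorem resolvent_mul_one_add_smul (hS : ∀ x, 0 ≤ inner ℝ (S x) x) (n : ℕ) :
    resolvent S n * (1 + (n : ℝ) • S) = 1 :=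
  Ring.inverse_mul_cancel _ (isUnit_one_add_smul hS n)

theorem resolvent_add (hS : ∀ x, 0 ≤ inner ℝ (S x) x) (n : ℕ) (x : X) :
    resolvent S n x + (n : ℝ) • S (resolvent S n x) = x := by
  simpa using DFunLike.congr_fun (one_add_smul_mul_resolvent hS n) x

theorem resolvent_add' (hS : ∀ x, 0 ≤ inner ℝ (S x) x) (n : ℕ) (x : X) :
    resolvent S n x + (n : ℝ) • resolvent S n (S x) = x := by
  simpa using DFunLike.congr_fun (resolvent_mul_one_add_smul hS n) x

theorem sub_resolvent (hS : ∀ x, 0 ≤ inner ℝ (S x) x) (n : ℕ) (x : X) :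
    x - resolvent S n x = (n : ℝ) • S (resolvent S n x) :=
  sub_eq_of_eq_add' (resolvent_add hS n x).symm

theorem norm_resolvent_le (hS : ∀ x, 0 ≤ inner ℝ (S x) x) (n : ℕ) (x : X) :
    ‖resolvent S n x‖ ≤ ‖x‖ := by
  set y := resolvent S n x
  have h : x = y + (n : ℝ) • S y := (resolvent_add hS n x).symm
  have h1 : inner ℝ x y = ‖y‖ ^ 2 + n * inner ℝ (S y) y := by
    rw [h]
    simp [inner_add_left, inner_smul_left]
  have h2 : 0 ≤ n * inner ℝ (S y) y := mul_nonneg n.cast_nonneg (hS y)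
  have h3 := real_inner_le_norm x y
  by_contra! hlt
  nlinarith [norm_nonneg x, norm_nonneg y]

theorem norm_yosidaSq_le (hS : ∀ x, 0 ≤ inner ℝ (S x) x) (n : ℕ) (x : X) :
    ‖yosidaSq S n x‖ ≤ 4 * ‖x‖ := by
  have h : ∀ x, ‖(1 - resolvent S n) x‖ ≤ 2 * ‖x‖ := fun x => by
    have := norm_sub_le x (resolvent S n x)
    have := norm_resolvent_le hS n x
    simp only [sub_apply, one_apply_eq_self]
    linarith
  calc ‖yosidaSq S n x‖ ≤ 2 * ‖(1 - resolvent S n) x‖ := h _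
    _ ≤ 4 * ‖x‖ := by linarith [h x]

theorem resolvent_apply_of_mem_ker (hS : ∀ x, 0 ≤ inner ℝ (S x) x) (n : ℕ) {x : X}
    (hx : S x = 0) : resolvent S n x = x := by
  simpa [hx] using resolvent_add' hS n x

/-- On the range, `n (1 + n S)⁻¹ S z = z - (1 + n S)⁻¹ z` has norm at most `2 ‖z‖`, which gives
decay of order `1/n`; contractivity extends this to the closure. -/
theorem tendsto_resolvent_of_mem_closure (hS : ∀ x, 0 ≤ inner ℝ (S x) x) {x : X}
    (hx : x ∈ closure (range S)) : Tendsto (fun n => resolvent S n x) atTop (𝓝 0) := by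
  rw [Metric.tendsto_nhds]
  intro ε hε
  obtain ⟨_, ⟨z, rfl⟩, hz⟩ := Metric.mem_closure_iff.1 hx (ε / 2) (by positivity)
  have hlim : Tendsto (fun n : ℕ => 2 * ‖z‖ / (n : ℝ)) atTop (𝓝 0) :=
    tendsto_const_div_atTop_nhds_zero_nat _
  filter_upwards [hlim.eventually_lt_const (show 0 < ε / 2 by positivity), eventually_gt_atTop 0]
    with n h1 h2
  have hn : (0 : ℝ) < n := by exact_mod_cast h2
  have h3 : ‖resolvent S n (S z)‖ ≤ 2 * ‖z‖ / n := by
    have e := resolvent_add' hS n z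
    have e1 : (n : ℝ) • resolvent S n (S z) = z - resolvent S n z := eq_sub_of_add_eq' e
    have e2 : n * ‖resolvent S n (S z)‖ = ‖z - resolvent S n z‖ := by
      rw [← e1, norm_smul, Real.norm_of_nonneg hn.le]
    rw [le_div_iff₀ hn, mul_comm, e2]
    linarith [norm_sub_le z (resolvent S n z), norm_resolvent_le hS n z]
  have h4 : ‖resolvent S n (x - S z)‖ ≤ ‖x - S z‖ := norm_resolvent_le hS n _
  rw [map_sub] at h4
  rw [dist_eq_norm] at hz
  rw [dist_zero_right]
  have := norm_sub_norm_le (resolvent S n x) (resolvent S n (S z))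
  linarith

/-- The orthogonal projection onto the closure of the range of a symmetric operator `S`. -/
noncomputable def rangeProj (S : X →L[ℝ] X) : X →L[ℝ] X :=
  1 - (LinearMap.ker S.toLinearMap).starProjection

theorem apply_starProjection_ker (x : X) :
    S ((LinearMap.ker S.toLinearMap).starProjection x) = 0 :=
  LinearMap.mem_ker.1 (Submodule.starProjection_apply_mem (LinearMap.ker S.toLinearMap) x)

theorem rangeProj_mem_closure (hsymm : ∀ x y, inner ℝ (S x) y = inner ℝ x (S y)) (x : X) :
    rangeProj S x ∈ closure (range S) := by
  have hadj : ContinuousLinearMap.adjoint S = S :=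
    (ContinuousLinearMap.eq_adjoint_iff S S).2 hsymm |>.symm
  have h := S.orthogonal_ker
  rw [hadj] at h
  have h1 : rangeProj S x ∈ (LinearMap.ker S.toLinearMap)ᗮ :=
    Submodule.sub_starProjection_mem_orthogonal x
  rw [h] at h1
  exact h1

/-- Split `x` along `ker S` and its complement. The resolvent fixes the first part, so `Y_n` kills
it; on the second the resolvent tends to `0`, so `Y_n` tends to the identity. -/
theorem tendsto_yosidaSq (hS : ∀ x, 0 ≤ inner ℝ (S x) x)
    (hsymm : ∀ x y, inner ℝ (S x) y = inner ℝ x (S y)) (x : X) :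
    Tendsto (fun n => yosidaSq S n x) atTop (𝓝 (rangeProj S x)) := by
  set k := (LinearMap.ker S.toLinearMap).starProjection x
  set z := rangeProj S x with hz
  have hxz : x = z + k := by simp [hz, k, rangeProj]
  have hk : ∀ n, resolvent S n k = k :=
    fun n => resolvent_apply_of_mem_ker hS n (apply_starProjection_ker x)
  have h1 := tendsto_resolvent_of_mem_closure hS (rangeProj_mem_closure hsymm x)
  have h2 : Tendsto (fun n => resolvent S n (resolvent S n z)) atTop (𝓝 0) :=
    squeeze_zero_norm (fun n => norm_resolvent_le hS n _) (tendsto_norm_zero.comp h1)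
  have h3 : Tendsto (fun n => z - resolvent S n z - (resolvent S n z - resolvent S n (resolvent S n z)))
      atTop (𝓝 (z - 0 - (0 - 0))) := (h1.const_sub z).sub (h1.sub h2)
  rw [sub_zero, sub_zero, sub_zero] at h3
  refine h3.congr fun n => ?_
  rw [hxz]
  simp only [yosidaSq, mul_apply_eq_comp, sub_apply,
    one_apply_eq_self, map_add, map_sub, hk]
  abel

end Resolvent

/-! ### The abstract evolution equation for an adjoint pair -/

theorem exists_continuousOn_limit {E : Type*} [NormedAddCommGroup E] [CompleteSpace E]
    {s : Set ℝ} {f : ℕ → ℝ → E} {a : ℕ → ℝ} (ha : Tendsto a atTop (𝓝 0))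
    (hf : ∀ n, ContinuousOn (f n) s)
    (hfa : ∀ n m, ∀ t ∈ s, ‖f n t - f m t‖ ≤ a n + a m) :
    ∃ F : ℝ → E, ContinuousOn F s ∧ ∀ t ∈ s, Tendsto (fun n => f n t) atTop (𝓝 (F t)) := by
  have hU : UniformCauchySeqOn f atTop s := by
    rw [Metric.uniformCauchySeqOn_iff]
    intro ε hε
    obtain ⟨N, hN⟩ := eventually_atTop.1 (ha.eventually_lt_const (half_pos hε))
    refine ⟨N, fun m hm n hn t ht => ?_⟩
    rw [dist_eq_norm]
    linarith [hfa m n t ht, hN m hm, hN n hn]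
  have hlim : ∀ t, ∃ x, t ∈ s → Tendsto (fun n => f n t) atTop (𝓝 x) := by
    intro t
    by_cases ht : t ∈ s
    · obtain ⟨x, hx⟩ := cauchySeq_tendsto_of_complete (hU.cauchy_map ht)
      exact ⟨x, fun _ => hx⟩
    · exact ⟨0, fun h => absurd h ht⟩
  choose F hF using hlim
  exact ⟨F, (hU.tendstoUniformlyOn_of_tendsto hF).continuousOn (Frequently.of_forall hf), hF⟩

section DualPair

variable {V H : Type*} [NormedAddCommGroup V] [InnerProductSpace ℝ V] [CompleteSpace V]
  [NormedAddCommGroup H] [InnerProductSpace ℝ H] [CompleteSpace H]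
  {j : V →L[ℝ] H} {K : H →L[ℝ] V}

omit [CompleteSpace V] [CompleteSpace H] in
theorem comp_nonneg (hjK : ∀ h v, inner ℝ (K h) v = inner ℝ h (j v)) (v : V) :
    0 ≤ inner ℝ ((K ∘L j) v) v := by
  rw [ContinuousLinearMap.comp_apply, hjK]
  exact real_inner_self_nonneg

-- The adjointness hypothesis is symmetric under exchanging `(V, j)` and `(H, K)`, so statements
-- about `K j` also apply to `j K`.
omit [CompleteSpace V] [CompleteSpace H] in
theorem dualPair_swap (hjK : ∀ h v, inner ℝ (K h) v = inner ℝ h (j v)) (v : V) (h : H) :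
    inner ℝ (j v) h = inner ℝ v (K h) := by
  rw [real_inner_comm, ← hjK, real_inner_comm]

omit [CompleteSpace V] [CompleteSpace H] in
theorem comp_symm (hjK : ∀ h v, inner ℝ (K h) v = inner ℝ h (j v)) (u v : V) :
    inner ℝ ((K ∘L j) u) v = inner ℝ u ((K ∘L j) v) := by
  rw [ContinuousLinearMap.comp_apply, ContinuousLinearMap.comp_apply, hjK]
  exact dualPair_swap hjK u (j v)

-- Since `(K j z, z) = |j z|²`, the kernel of `K j` is that of `j`, and the range of the adjoint `K`
-- is orthogonal to it.
omit [CompleteSpace H] in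
theorem starProjection_ker_comp_apply (hjK : ∀ h v, inner ℝ (K h) v = inner ℝ h (j v)) (h : H) :
    (LinearMap.ker (K ∘L j).toLinearMap).starProjection (K h) = 0 := by
  rw [Submodule.starProjection_apply_eq_zero_iff, Submodule.mem_orthogonal]
  intro z hz
  have hz' : K (j z) = 0 := hz
  have hj : j z = 0 := by
    rw [← inner_self_eq_zero (𝕜 := ℝ), ← hjK, hz', inner_zero_left]
  rw [real_inner_comm, hjK, hj, inner_zero_right]

/-- Invert both factors in `K (1 + n j K) = (1 + n K j) K`. -/
theorem comp_resolvent_comm (hjK : ∀ h v, inner ℝ (K h) v = inner ℝ h (j v)) (n : ℕ) (h : H) :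
    K (resolvent (j ∘L K) n h) = resolvent (K ∘L j) n (K h) := by
  have h1 := resolvent_add (S := j ∘L K) (comp_nonneg (dualPair_swap hjK)) n h
  have h2 := resolvent_add' (S := K ∘L j) (comp_nonneg hjK) n (K (resolvent (j ∘L K) n h))
  conv_rhs => rw [← h1]
  rw [← h2]
  simp

/-- `n² (1 + n S)⁻²` with `S = K j`. -/
noncomputable def resolventSq (j : V →L[ℝ] H) (K : H →L[ℝ] V) (n : ℕ) : V →L[ℝ] V :=
  ((n : ℝ) * n) • (resolvent (K ∘L j) n ∘L resolvent (K ∘L j) n)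

theorem comp_resolvent (hjK : ∀ h v, inner ℝ (K h) v = inner ℝ h (j v)) (n : ℕ) (v : V) :
    K (j (resolvent (K ∘L j) n v)) = resolvent (K ∘L j) n (K (j v)) := by
  rw [comp_resolvent_comm (dualPair_swap hjK), comp_resolvent_comm hjK]

theorem resolventSq_comm (hjK : ∀ h v, inner ℝ (K h) v = inner ℝ h (j v)) (n : ℕ) (v : V) :
    K (j (resolventSq j K n v)) = resolventSq j K n (K (j v)) := by
  simp [resolventSq, comp_resolvent hjK]

/-- Each factor is `n S (1 + n S)⁻¹`, and `S` commutes with its resolvent. -/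
theorem yosidaSq_apply (hjK : ∀ h v, inner ℝ (K h) v = inner ℝ h (j v)) (n : ℕ) (v : V) :
    yosidaSq (K ∘L j) n v = K (j (resolventSq j K n (K (j v)))) := by
  have h : ∀ v, (1 - resolvent (K ∘L j) n) v = (n : ℝ) • K (j (resolvent (K ∘L j) n v)) :=
    fun v => sub_resolvent (comp_nonneg hjK) n v
  simp only [yosidaSq, mul_apply_eq_comp, h, resolventSq]
  simp [comp_resolvent hjK, smul_smul]

theorem resolventSq_intertwine (hjK : ∀ h v, inner ℝ (K h) v = inner ℝ h (j v)) (n : ℕ) (h : H) :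
    j (resolventSq j K n (K h)) = resolventSq K j n (j (K h)) := by
  simp [resolventSq, comp_resolvent_comm (dualPair_swap hjK)]

/-- The energy estimate for `p' = γ - θ`, `p = K j θ'`. -/
theorem energy_bound (hjK : ∀ h v, inner ℝ (K h) v = inner ℝ h (j v)) {T : ℝ} (hT : 0 ≤ T)
    {θ d γ : ℝ → V} (hd : IntervalIntegrable d volume 0 T)
    (hγ : IntervalIntegrable γ volume 0 T)
    (hθ : ∀ t ∈ Icc 0 T, θ t = θ 0 + ∫ s in (0 : ℝ)..t, d s)
    (hp : ∀ t ∈ Icc 0 T, K (j (d t)) = K (j (d 0)) + ∫ s in (0 : ℝ)..t, (γ s - θ s))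
    {t : ℝ} (ht : t ∈ Icc 0 T) :
    ‖K (j (d t))‖ ≤ ‖K (j (d 0))‖ + ‖j (θ 0)‖ + 2 * ∫ s in (0 : ℝ)..T, ‖γ s‖ ∧
    ‖j (θ t)‖ ≤ ‖K (j (d 0))‖ + ‖j (θ 0)‖ + 2 * ∫ s in (0 : ℝ)..T, ‖γ s‖ := by
  have hu : uIcc 0 T = Icc 0 T := uIcc_of_le hT
  have primitive_cont : ∀ {f f' : ℝ → V}, IntervalIntegrable f' volume 0 T →
      (∀ t ∈ Icc 0 T, f t = f 0 + ∫ s in (0 : ℝ)..t, f' s) → ContinuousOn f (Icc 0 T) := by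
    intro f f' hf' hf
    refine ContinuousOn.congr ?_ hf
    rw [← hu]
    exact continuousOn_const.add
      (intervalIntegral.continuousOn_primitive_interval' hf' left_mem_uIcc)
  have hθc := primitive_cont hd hθ
  have hθi : IntervalIntegrable θ volume 0 T := (hu ▸ hθc : ContinuousOn θ (uIcc 0 T)).intervalIntegrable
  set p : ℝ → V := fun t => K (j (d t)) with hp_def
  have hpc : ContinuousOn p (Icc 0 T) := primitive_cont (hγ.sub hθi) hp
  have hjd : IntervalIntegrable (fun s => j (d s)) volume 0 T :=
    ⟨j.integrable_comp hd.1, j.integrable_comp hd.2⟩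
  have hjθ : ∀ t ∈ Icc 0 T, j (θ t) = j (θ 0) + ∫ s in (0 : ℝ)..t, j (d s) := by
    intro t ht
    rw [j.intervalIntegral_comp_comm
      (hd.mono_set (uIcc_subset_uIcc left_mem_uIcc (hu ▸ ht))), ← map_add, ← hθ t ht]
  obtain ⟨i1, n1⟩ := norm_sq_eq_add_integral_inner hT (hγ.sub hθi) hp
  obtain ⟨i2, n2⟩ := norm_sq_eq_add_integral_inner hT (x := fun t => j (θ t)) hjd hjθ
  set e : ℝ → ℝ := fun t => ‖p t‖ ^ 2 + ‖j (θ t)‖ ^ 2 with he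
  have hee : ∀ t ∈ Icc 0 T, e t = e 0 + ∫ s in (0 : ℝ)..t, 2 * inner ℝ (p s) (γ s) := by
    intro t ht
    have hsub : uIcc 0 t ⊆ uIcc 0 T := uIcc_subset_uIcc left_mem_uIcc (hu ▸ ht)
    simp only [he]
    rw [n1 t ht, n2 t ht, add_add_add_comm, ← intervalIntegral.integral_add
      ((i1.const_mul 2).mono_set hsub) ((i2.const_mul 2).mono_set hsub)]
    congr 1
    refine intervalIntegral.integral_congr fun s _ => ?_
    simp only [inner_sub_right]
    -- By adjointness the cross terms of the two energies cancel; only the work of `γ` remains.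
    have e1 : inner ℝ (K (j (d s))) (θ s) = inner ℝ (j (θ s)) (j (d s)) := by
      rw [hjK, real_inner_comm]
    rw [e1]
    simp only [hp_def]
    ring
  have hec : ContinuousOn e (Icc 0 T) :=
    (hpc.norm.pow 2).add ((j.continuous.comp_continuousOn hθc).norm.pow 2)
  -- At the maximum of the energy, `m = √(e r)` satisfies `m² ≤ e 0 + 2 m Γ`. This yields a bound
  -- linear in the data without Gronwall.
  obtain ⟨r, hr, hmax⟩ := isCompact_Icc.exists_isMaxOn ⟨0, le_rfl, hT⟩ hec
  have he0 : ∀ t, 0 ≤ e t := fun t => by positivity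
  set m := √(e r) with hm
  have hm2 : m ^ 2 = e r := Real.sq_sqrt (he0 r)
  have hm0 : 0 ≤ m := Real.sqrt_nonneg _
  have hpm : ∀ s ∈ Icc 0 T, ‖p s‖ ≤ m ∧ ‖j (θ s)‖ ≤ m := by
    intro s hs
    have h1 : e s ≤ e r := hmax hs
    constructor <;> refine Real.le_sqrt_of_sq_le (le_trans ?_ h1) <;> simp only [he] <;>
      nlinarith [sq_nonneg ‖p s‖, sq_nonneg ‖j (θ s)‖]
  set Γ := ∫ s in (0 : ℝ)..T, ‖γ s‖ with hΓ
  have hΓ0 : 0 ≤ Γ := intervalIntegral.integral_nonneg hT fun _ _ => norm_nonneg _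
  have hbound : e r ≤ e 0 + 2 * m * Γ := by
    have h1 : ∫ s in (0 : ℝ)..r, 2 * inner ℝ (p s) (γ s) ≤ ∫ s in (0 : ℝ)..r, 2 * m * ‖γ s‖ := by
      refine (Real.le_norm_self _).trans ?_
      refine intervalIntegral.norm_integral_le_of_norm_le hr.1 (ae_of_all _ fun s hs => ?_)
        ((hγ.norm.const_mul _).mono_set (uIcc_subset_uIcc left_mem_uIcc (hu ▸ hr)))
      rw [norm_mul, Real.norm_of_nonneg zero_le_two, mul_assoc]
      refine mul_le_mul_of_nonneg_left ((norm_inner_le_norm _ _).trans ?_) zero_le_two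
      exact mul_le_mul_of_nonneg_right (hpm s ⟨hs.1.le, hs.2.trans hr.2⟩).1 (norm_nonneg _)
    have h2 : ∫ s in (0 : ℝ)..r, 2 * m * ‖γ s‖ ≤ ∫ s in (0 : ℝ)..T, 2 * m * ‖γ s‖ :=
      intervalIntegral.integral_mono_interval le_rfl hr.1 hr.2
        (ae_of_all _ fun s => by positivity) (hγ.norm.const_mul _)
    rw [hee r hr]
    rw [intervalIntegral.integral_const_mul _ (fun s => ‖γ s‖) (a := 0) (b := T)] at h2
    linarith
  have hfin : m ≤ ‖p 0‖ + ‖j (θ 0)‖ + 2 * Γ := by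
    have ha := norm_nonneg (p 0)
    have hb := norm_nonneg (j (θ 0))
    have he0' : e 0 ≤ (‖p 0‖ + ‖j (θ 0)‖) ^ 2 := by
      simp only [he]
      nlinarith
    by_contra! hlt
    nlinarith
  exact ⟨(hpm t ht).1.trans hfin, (hpm t ht).2.trans hfin⟩

theorem tendsto_integral_yosidaSq {S : V →L[ℝ] V} (hS : ∀ x, 0 ≤ inner ℝ (S x) x)
    (hsymm : ∀ x y, inner ℝ (S x) y = inner ℝ x (S y)) {T : ℝ} {G : ℝ → V}
    (hG : IntervalIntegrable G volume 0 T) :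
    Tendsto (fun n => ∫ s in (0 : ℝ)..T, ‖yosidaSq S n (G s) - rangeProj S (G s)‖) atTop
      (𝓝 0) := by
  have hGm := hG.aestronglyMeasurable_restrict_uIoc
  have h := intervalIntegral.tendsto_integral_filter_of_dominated_convergence
    (a := 0) (b := T) (μ := volume) (l := atTop) (f := fun _ => (0 : ℝ))
    (F := fun (n : ℕ) s => ‖yosidaSq S n (G s) - rangeProj S (G s)‖)
    (fun s => 4 * ‖G s‖ + ‖rangeProj S‖ * ‖G s‖) ?_ ?_ ?_ ?_
  · simpa using h
  · refine Eventually.of_forall fun n => ?_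
    exact (((yosidaSq S n).continuous.comp_aestronglyMeasurable hGm).sub
      ((rangeProj S).continuous.comp_aestronglyMeasurable hGm)).norm
  · refine Eventually.of_forall fun n => ae_of_all _ fun s _ => ?_
    rw [norm_norm]
    exact (norm_sub_le _ _).trans
      (add_le_add (norm_yosidaSq_le hS n _) ((rangeProj S).le_opNorm _))
  · exact (hG.norm.const_mul _).add (hG.norm.const_mul _)
  · refine ae_of_all _ fun s _ => ?_
    exact tendsto_iff_norm_sub_tendsto_zero.1 (tendsto_yosidaSq hS hsymm (G s))

/-- Regularity for `(K j η)'' + η = K j G`, where `(K j η)' = K η₁` and `(K j η)'' = y₂`. -/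
theorem abstract_regularity (hjK : ∀ h v, inner ℝ (K h) v = inner ℝ h (j v)) {T : ℝ} (hT : 0 < T)
    {η G y₂ : ℝ → V} {η₁ : ℝ → H} (hη : IntegrableOn η (Ioo 0 T))
    (hG : IntegrableOn G (Ioo 0 T)) (hy₂ : IntegrableOn y₂ (Ioo 0 T))
    (hη₁ : IntegrableOn η₁ (Ioo 0 T))
    (hw₁ : IsWeakDeriv (Ioo 0 T) (fun t => j (η t)) η₁)
    (hw₂ : IsWeakDeriv (Ioo 0 T) (fun t => K (η₁ t)) y₂)
    (heq : ∀ᵐ t ∂(volume.restrict (Ioo 0 T)), y₂ t + η t = K (j (G t))) {h₀ : H} {v₀ : V}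
    (hi₁ : HasInitialValue T (fun t => j (η t)) (j (K h₀)))
    (hi₂ : HasInitialValue T (fun t => K (η₁ t)) (K (j v₀))) :
    (∃ h : ℝ → H, ContinuousOn h (Icc 0 T) ∧
      ∀ᵐ t ∂(volume.restrict (Ioo 0 T)), K (h t) = η t) ∧
    ∃ w : ℝ → V, ContinuousOn w (Icc 0 T) ∧
      ∀ᵐ t ∂(volume.restrict (Ioo 0 T)), j (w t) = η₁ t := by
  have hKj := dualPair_swap hjK
  have hioo : ∀ {E : Type _} [NormedAddCommGroup E] {f : ℝ → E}, IntegrableOn f (Ioo 0 T) →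
      IntervalIntegrable f volume 0 T := fun hf =>
    (intervalIntegrable_iff_integrableOn_Ioo_of_le hT.le).2 hf
  have hu : uIcc 0 T = Icc 0 T := uIcc_of_le hT.le
  have hjη : IntegrableOn (fun t => j (η t)) (Ioo 0 T) := j.integrable_comp hη
  have hKη₁ : IntegrableOn (fun t => K (η₁ t)) (Ioo 0 T) := K.integrable_comp hη₁
  obtain ⟨U, hUc, hUe, hU0⟩ := hi₁
  obtain ⟨Q, hQc, hQe, hQ0⟩ := hi₂
  -- the components of `η` and `η₁` in the kernels vanish
  have hker : ∀ᵐ t ∂(volume.restrict (Ioo 0 T)), rangeProj (K ∘L j) (η t) = η t := by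
    set P := (LinearMap.ker (K ∘L j).toLinearMap).starProjection with hP
    -- As `P K = 0`, `P` annihilates `K η₁` and hence its weak derivative `y₂`; the equation then
    -- gives `P η = 0`.
    have h1 := (hw₂.comp_clm hKη₁ hy₂ P).ae_eq_zero (P.integrable_comp hy₂)
      (ae_of_all _ fun t => starProjection_ker_comp_apply hjK _)
    filter_upwards [h1, heq] with t h1 h2
    have h3 : η t = K (j (G t)) - y₂ t := eq_sub_of_add_eq' h2
    have h4 : P (η t) = 0 := by
      rw [h3, map_sub, h1, sub_zero]
      exact starProjection_ker_comp_apply hjK _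
    change η t - P (η t) = η t
    rw [h4, sub_zero]
  have hker₁ : ∀ᵐ t ∂(volume.restrict (Ioo 0 T)), rangeProj (j ∘L K) (η₁ t) = η₁ t := by
    set P := (LinearMap.ker (j ∘L K).toLinearMap).starProjection with hP
    have h1 := (hw₁.comp_clm hjη hη₁ P).ae_eq_zero (P.integrable_comp hη₁)
      (ae_of_all _ fun t => starProjection_ker_comp_apply hKj _)
    filter_upwards [h1] with t h1
    change η₁ t - P (η₁ t) = η₁ t
    rw [h1, sub_zero]
  -- integral representations of `K j η` and `K η₁`
  set y : ℝ → V := fun t => K (U t) with hy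
  have hyc : ContinuousOn y (Icc 0 T) := K.continuous.comp_continuousOn hUc
  have hye : ∀ᵐ t ∂(volume.restrict (Ioo 0 T)), y t = K (j (η t)) := by
    filter_upwards [hUe] with t ht
    simp only [hy, ht]
  have hyi : ∀ t ∈ Icc 0 T, y t = y 0 + ∫ s in (0 : ℝ)..t, Q s := by
    have h1 := (hw₁.comp_clm hjη hη₁ K).eq_add_integral hT (hioo hKη₁) hyc hye
    intro t ht
    rw [h1 t ht]
    congr 1
    refine intervalIntegral.integral_congr_ae ?_
    rw [uIoc_of_le ht.1]
    rw [ae_restrict_iff' measurableSet_Ioo] at hQe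
    have hneT : ∀ᵐ s : ℝ, s ≠ T := by simp [ae_iff]
    filter_upwards [hQe, hneT] with s hs hs' hst
    exact (hs ⟨hst.1, lt_of_le_of_ne (hst.2.trans ht.2) hs'⟩).symm
  have hQi : ∀ t ∈ Icc 0 T, Q t = Q 0 + ∫ s in (0 : ℝ)..t, y₂ s :=
    hw₂.eq_add_integral hT (hioo hy₂) hQc hQe
  have hQint : IntervalIntegrable Q volume 0 T :=
    (hu ▸ hQc : ContinuousOn Q (uIcc 0 T)).intervalIntegrable
  -- the regularized solutions
  set Y := yosidaSq (K ∘L j) with hY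
  set Y' := yosidaSq (j ∘L K) with hY'
  set Pr := rangeProj (K ∘L j) with hPr
  set Pr' := rangeProj (j ∘L K) with hPr'
  have hYlim : ∀ v, Tendsto (fun n => Y n v) atTop (𝓝 (Pr v)) :=
    tendsto_yosidaSq (comp_nonneg hjK) (comp_symm hjK)
  have hYlim' : ∀ v, Tendsto (fun n => Y' n v) atTop (𝓝 (Pr' v)) :=
    tendsto_yosidaSq (comp_nonneg hKj) (comp_symm hKj)
  set A := resolventSq j K with hA
  have hY_apply : ∀ n v, K (j (A n (K (j v)))) = Y n v :=
    fun n v => (yosidaSq_apply hjK n v).symm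
  have hYcomm : ∀ n v, K (j (A n v)) = A n (K (j v)) := resolventSq_comm hjK
  have hY'_apply : ∀ n h, j (A n (K (j (K h)))) = Y' n h := by
    intro n h
    rw [hY', yosidaSq_apply hKj, hA, resolventSq_intertwine hjK, resolventSq_comm hKj]
  have hY'_apply' : ∀ n h, j (K (j (A n (K h)))) = Y' n h := by
    intro n h
    rw [hYcomm, hY'_apply]
  -- The three terms measure how far the data of the regularized problem, `p 0`, `j (θ 0)` and the
  -- source, are from their limits.
  set a : ℕ → ℝ := fun n => ‖Y n v₀ - Pr v₀‖ + ‖Y' n h₀ - Pr' h₀‖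
    + 2 * ∫ s in (0 : ℝ)..T, ‖Y n (G s) - Pr (G s)‖ with ha
  have halim : Tendsto a atTop (𝓝 0) := by
    have h1 := tendsto_iff_norm_sub_tendsto_zero.1 (hYlim v₀)
    have h2 := tendsto_iff_norm_sub_tendsto_zero.1 (hYlim' h₀)
    have h3 := tendsto_integral_yosidaSq (comp_nonneg hjK) (comp_symm hjK) (hioo hG)
    simpa using (h1.add h2).add (h3.const_mul 2)
  have hYG : ∀ n, IntervalIntegrable (fun s => Y n (G s)) volume 0 T :=
    fun n => hioo ((Y n).integrable_comp hG)
  have hPrG : IntervalIntegrable (fun s => Pr (G s)) volume 0 T := hioo (Pr.integrable_comp hG)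
  have hdiff : ∀ n m, ∀ t ∈ Icc 0 T,
      ‖K (j (A n (Q t))) - K (j (A m (Q t)))‖ ≤ a n + a m ∧
      ‖j (A n (y t)) - j (A m (y t))‖ ≤ a n + a m := by
    intro n m t ht
    set B := A n - A m with hB
    have hKjB : ∀ v, K (j (B (K (j v)))) = Y n v - Y m v := by
      intro v
      simp only [hB, sub_apply, map_sub, hY_apply]
    have hKjBcomm : ∀ v, K (j (B v)) = B (K (j v)) := by
      intro v
      simp only [hB, sub_apply, map_sub, hYcomm]
    have hclm : ∀ (C : V →L[ℝ] V) {f f' : ℝ → V}, IntervalIntegrable f' volume 0 T →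
        (∀ t ∈ Icc 0 T, f t = f 0 + ∫ s in (0 : ℝ)..t, f' s) →
        ∀ t ∈ Icc 0 T, C (f t) = C (f 0) + ∫ s in (0 : ℝ)..t, C (f' s) := by
      intro C f f' hf' hf t ht
      rw [C.intervalIntegral_comp_comm
        (hf'.mono_set (uIcc_subset_uIcc left_mem_uIcc (hu ▸ ht))), ← map_add, ← hf t ht]
    have hp : ∀ t ∈ Icc 0 T, K (j (B (Q t))) = K (j (B (Q 0)))
        + ∫ s in (0 : ℝ)..t, ((Y n (G s) - Y m (G s)) - B (y s)) := by
      intro t ht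
      have h1 := hclm (K ∘L j ∘L B) (hioo hy₂) hQi t ht
      simp only [ContinuousLinearMap.comp_apply] at h1
      rw [h1]
      congr 1
      refine intervalIntegral.integral_congr_ae ?_
      rw [uIoc_of_le ht.1]
      have hall := hye.and heq
      rw [ae_restrict_iff' measurableSet_Ioo] at hall
      have hneT : ∀ᵐ s : ℝ, s ≠ T := by simp [ae_iff]
      filter_upwards [hall, hneT] with s hs hs' hst
      obtain ⟨e1, e2⟩ := hs ⟨hst.1, lt_of_le_of_ne (hst.2.trans ht.2) hs'⟩
      -- Insert `y₂ = S G - η` and use `S B S = Y_n - Y_m` and `S B = B S`.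
      rw [e1, eq_sub_of_add_eq e2, ← hKjB, ← hKjBcomm (η s)]
      simp only [map_sub]
    have hE := energy_bound hjK hT.le (θ := fun t => B (y t)) (d := fun t => B (Q t))
      (γ := fun s => Y n (G s) - Y m (G s))
      ⟨B.integrable_comp hQint.1, B.integrable_comp hQint.2⟩ ((hYG n).sub (hYG m))
      (hclm B hQint hyi) hp ht
    have hsum : ‖K (j (B (Q 0)))‖ + ‖j (B (y 0))‖
        + 2 * ∫ s in (0 : ℝ)..T, ‖Y n (G s) - Y m (G s)‖ ≤ a n + a m := by
      have h1 : ‖K (j (B (Q 0)))‖ ≤ ‖Y n v₀ - Pr v₀‖ + ‖Y m v₀ - Pr v₀‖ := by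
        rw [hQ0, hKjB, norm_sub_rev (Y m v₀)]
        exact norm_sub_le_norm_sub_add_norm_sub _ _ _
      have h2 : ‖j (B (y 0))‖ ≤ ‖Y' n h₀ - Pr' h₀‖ + ‖Y' m h₀ - Pr' h₀‖ := by
        simp only [hy]
        rw [hU0]
        simp only [hB, sub_apply, map_sub, hY'_apply]
        rw [norm_sub_rev (Y' m h₀)]
        exact norm_sub_le_norm_sub_add_norm_sub _ _ _
      have h3 : ∫ s in (0 : ℝ)..T, ‖Y n (G s) - Y m (G s)‖
          ≤ (∫ s in (0 : ℝ)..T, ‖Y n (G s) - Pr (G s)‖)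
            + ∫ s in (0 : ℝ)..T, ‖Y m (G s) - Pr (G s)‖ := by
        rw [← intervalIntegral.integral_add ((hYG n).sub hPrG).norm ((hYG m).sub hPrG).norm]
        refine intervalIntegral.integral_mono_on hT.le ((hYG n).sub (hYG m)).norm
          (((hYG n).sub hPrG).norm.add ((hYG m).sub hPrG).norm) fun s _ => ?_
        rw [norm_sub_rev (Y m (G s)) (Pr (G s))]
        exact norm_sub_le_norm_sub_add_norm_sub _ _ _
      simp only [ha]
      linarith
    have hE1 := hE.1.trans hsum
    have hE2 := hE.2.trans hsum
    simp only [hB, sub_apply, map_sub] at hE1 hE2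
    exact ⟨hE1, hE2⟩
  constructor
  · obtain ⟨h, hc, hlim⟩ := exists_continuousOn_limit (f := fun n t => j (A n (y t))) halim
      (fun n => (j ∘L A n).continuous.comp_continuousOn hyc) fun n m t ht => (hdiff n m t ht).2
    refine ⟨h, hc, ?_⟩
    filter_upwards [hye, hker, ae_restrict_mem measurableSet_Ioo] with t h1 h2 h3
    -- `K h` is the limit of `K j A_n K j η = Y_n η`, that is, the projection of `η`, which is `η`
    -- itself.
    have h4 := (K.continuous.tendsto _).comp (hlim t (Ioo_subset_Icc_self h3))
    have h5 := hYlim (η t)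
    rw [h2] at h5
    refine tendsto_nhds_unique h4 (h5.congr fun n => ?_)
    simp only [Function.comp_apply]
    rw [h1, hY_apply]
  · obtain ⟨w, hc, hlim⟩ := exists_continuousOn_limit (f := fun n t => K (j (A n (Q t)))) halim
      (fun n => (K ∘L j ∘L A n).continuous.comp_continuousOn hQc) fun n m t ht => (hdiff n m t ht).1
    refine ⟨w, hc, ?_⟩
    filter_upwards [hQe, hker₁, ae_restrict_mem measurableSet_Ioo] with t h1 h2 h3
    have h4 := (j.continuous.tendsto _).comp (hlim t (Ioo_subset_Icc_self h3))
    have h5 := hYlim' (η₁ t)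
    rw [h2] at h5
    refine tendsto_nhds_unique h4 (h5.congr fun n => ?_)
    simp only [Function.comp_apply]
    rw [h1, hY'_apply']

end DualPair

/-! ### The concrete spaces and the Riesz isomorphism -/

theorem integral_smul_eq_inner {L : ℝ≥0∞} {χ : ℝ → ℝ}
    (hχ : MemLp χ 2 (volume.restrict (I L))) (u : H L) :
    ∫ x in I L, χ x • u x = inner ℝ (hχ.toLp χ) u := by
  rw [L2.inner_def]
  refine integral_congr_ae ?_
  filter_upwards [hχ.coeFn_toLp] with x hx
  rw [hx, smul_eq_mul, mul_comm]
  rfl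

/-- For each test function, the defining identity equates two `L²` pairings that are continuous in
the pair. -/
theorem isClosed_sobolevH1 (L : ℝ≥0∞) : IsClosed (sobolevH1 L : Set (HH L)) := by
  have hfst : Continuous fun p : HH L => p.fst := (WithLp.fstL 2 ℝ (H L) (H L)).continuous
  have hsnd : Continuous fun p : HH L => p.snd := (WithLp.sndL 2 ℝ (H L) (H L)).continuous
  have h : (sobolevH1 L : Set (HH L)) = ⋂ ψ : ℝ → ℝ, ⋂ _ : IsTestFunction (I L) ψ,
      {p : HH L | ∫ x in I L, deriv ψ x • p.fst x = -∫ x in I L, ψ x • p.snd x} := by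
    ext p
    simp only [mem_iInter]
    rfl
  rw [h]
  refine isClosed_iInter fun ψ => isClosed_iInter fun hψ => ?_
  have hd : Continuous (deriv ψ) := hψ.contDiff.continuous_deriv (by simp)
  have m1 : MemLp (deriv ψ) 2 (volume.restrict (I L)) :=
    hd.memLp_of_hasCompactSupport hψ.hasCompactSupport.deriv
  have m2 : MemLp ψ 2 (volume.restrict (I L)) :=
    hψ.contDiff.continuous.memLp_of_hasCompactSupport hψ.hasCompactSupport
  simp only [integral_smul_eq_inner m1, integral_smul_eq_inner m2]
  exact isClosed_eq (continuous_const.inner hfst) (continuous_const.inner hsnd).neg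

instance completeSpace_V (L : ℝ≥0∞) (bc : BoundaryCondition) : CompleteSpace (V L bc) := by
  cases bc with
  | dirichlet =>
    exact (Submodule.isClosed_topologicalClosure _).isComplete.completeSpace_coe
  | neumann => exact (isClosed_sobolevH1 L).isComplete.completeSpace_coe

variable {L : ℝ≥0∞} {bc : BoundaryCondition} {κ : ℝ}

/-- The inverse `V* → V` of the Riesz isomorphism. -/
noncomputable def rieszInv (L : ℝ≥0∞) (bc : BoundaryCondition) : Vdual L bc →L[ℝ] V L bc :=
  LinearMap.mkContinuous
    { toFun := fun l => (InnerProductSpace.toDual ℝ (V L bc)).symm l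
      map_add' := fun l m => map_add _ l m
      map_smul' := fun c l => by
        rw [map_smulₛₗ]
        rfl } 1 fun l => by
    rw [one_mul]
    exact ((InnerProductSpace.toDual ℝ (V L bc)).symm.norm_map l).le

theorem inner_rieszInv (l : Vdual L bc) (v : V L bc) : inner ℝ (rieszInv L bc l) v = l v :=
  InnerProductSpace.toDual_symm_apply

/-- The adjoint `H → V` of the embedding `V → H`. -/
noncomputable def adjH (L : ℝ≥0∞) (bc : BoundaryCondition) : H L →L[ℝ] V L bc :=
  ContinuousLinearMap.adjoint (toH L bc)

theorem inner_adjH (h : H L) (v : V L bc) :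
    inner ℝ (adjH L bc h) v = inner ℝ h (toH L bc v) :=
  ContinuousLinearMap.adjoint_inner_left _ _ _

theorem toDual_apply (h : H L) (v : V L bc) : toDual L bc h v = inner ℝ h (toH L bc v) := rfl

theorem rieszInv_toDual (h : H L) : rieszInv L bc (toDual L bc h) = adjH L bc h :=
  ext_inner_right ℝ fun v => by rw [inner_rieszInv, inner_adjH, toDual_apply]

/-- The shift by `-1` comes from `(u_x, v_x) = ((u, v)) - (u, v)`. -/
theorem opA_apply (u v : V L bc) :
    opA L bc κ u v = inner ℝ u v + (κ - 1) * inner ℝ (toH L bc u) (toH L bc v) := by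
  have h1 : inner ℝ u v = inner ℝ (toH L bc u) (toH L bc v)
      + inner ℝ (derivX L bc u) (derivX L bc v) := rfl
  have h2 : opA L bc κ u v = inner ℝ (derivX L bc u) (derivX L bc v)
      + κ * inner ℝ (toH L bc u) (toH L bc v) := rfl
  rw [h1, h2]
  ring

theorem rieszInv_opA (u : V L bc) :
    rieszInv L bc (opA L bc κ u) = u + (κ - 1) • adjH L bc (toH L bc u) :=
  ext_inner_right ℝ fun v => by
    rw [inner_rieszInv, opA_apply, inner_add_left, real_inner_smul_left, inner_adjH]

theorem opA_adjH (h : H L) :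
    opA L bc κ (adjH L bc h)
      = toDual L bc (h + (κ - 1) • toH L bc (adjH L bc h)) :=
  ContinuousLinearMap.ext fun v => by
    rw [opA_apply, toDual_apply, inner_add_left, real_inner_smul_left, inner_adjH]

theorem mem_domain (p : WithLp 2 (V L bc × H L)) :
    p ∈ domain L bc κ ↔ opA L bc κ p.fst = toDual L bc p.snd := by
  rw [← sub_eq_zero]
  rfl

/-- The element of `D(𝒜)` given by `h ∈ H` through the Riesz isomorphism of `V`. -/
noncomputable def domainOfH (L : ℝ≥0∞) (bc : BoundaryCondition) (κ : ℝ) (h : H L) : DA L bc κ :=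
  ⟨WithLp.toLp 2 (adjH L bc h, h + (κ - 1) • toH L bc (adjH L bc h)),
    (mem_domain _).2 (opA_adjH h)⟩

theorem continuous_domainOfH : Continuous (domainOfH L bc κ) := by
  refine Continuous.subtype_mk ?_ _
  refine (WithLp.prod_continuous_toLp 2 (V L bc) (H L)).comp ?_
  fun_prop

theorem MemL2.integrableOn {X : Type*} [NormedAddCommGroup X] {T : ℝ} {u : ℝ → X}
    (hu : MemL2 T u) : IntegrableOn u (Ioo 0 T) :=
  MemLp.integrable (by norm_num) hu

end SineGordon

theorem theorem3
    (L : ℝ≥0∞) (hL : 0 < L) (bc : SineGordon.BoundaryCondition) (κ : ℝ) (hκ : 0 ≤ κ)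
    (T : ℝ) (hT : 0 < T) (ε : ℝ) (hε : 0 < ε)
    (φ : ℝ → ℝ → ℝ) (hφ : Measurable (Function.uncurry φ))
    (g : ℝ → SineGordon.H L) (hg : SineGordon.MemL2 T g)
    (u₀ : SineGordon.V L bc) (v₀ : SineGordon.H L)
    (η : ℝ → SineGordon.V L bc) (η₁ : ℝ → SineGordon.H L) (η₂ : ℝ → SineGordon.Vdual L bc)
    (hη : SineGordon.IsWeakSolution L bc κ T (SineGordon.forcing ε φ hφ g) u₀ v₀ η η₁ η₂)
    (hu₀ : u₀ ∈ Set.range (SineGordon.toV L bc κ))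
    (hv₀ : v₀ ∈ Set.range (SineGordon.toH L bc))
    (hf : SineGordon.MemL2In T (SineGordon.toH L bc)
      (fun t => SineGordon.forcing ε φ hφ g t (SineGordon.toH L bc (η t)))) :
    SineGordon.MemCIn T (SineGordon.toV L bc κ) η ∧
    SineGordon.MemCIn T (SineGordon.toH L bc) η₁ ∧
    SineGordon.MemL2In T (SineGordon.toDual L bc) η₂ := by
  open SineGordon in
  obtain ⟨w, hw, hwf⟩ := hf
  obtain ⟨d, rfl⟩ := hu₀
  obtain ⟨v₀, rfl⟩ := hv₀
  set j := toH L bc with hj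
  set K := adjH L bc with hK
  have hd : opA L bc κ (toV L bc κ d) = toDual L bc d.1.snd := (mem_domain _).1 d.2
  -- Applying Riesz to `𝒜 u₀ ∈ H` exhibits `u₀` as an element of the range of `K`, the form of the
  -- initial value that `abstract_regularity` takes.
  have hu₀ : toV L bc κ d = K (d.1.snd + (1 - κ) • j (toV L bc κ d)) := by
    have h := congrArg (rieszInv L bc) hd
    rw [rieszInv_opA, rieszInv_toDual] at h
    rw [map_add, map_smul, ← h, ← hj, ← hK]
    module
  have hi₁ := hη.init
  rw [hu₀] at hi₁
  have hi₂ : HasInitialValue T (fun t => K (η₁ t)) (K (j v₀)) := by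
    obtain ⟨W, hc, he, h0⟩ := hη.init_deriv
    refine ⟨fun t => rieszInv L bc (W t), (rieszInv L bc).continuous.comp_continuousOn hc, ?_, ?_⟩
    · filter_upwards [he] with t ht
      rw [ht, rieszInv_toDual]
    · simp only [h0, rieszInv_toDual, hK, hj]
  have hηi := hη.memL2.integrableOn
  have hη₁i := hη.memL2_deriv.integrableOn
  have hη₂i := hη.memL2_deriv2.integrableOn
  -- The lower-order part `(κ - 1) K j η` of `𝒜` is moved into the source; this keeps the source in
  -- `V` because `η` takes values there.
  have hG : MemL2 T (fun t => w t + (1 - κ) • η t) := hw.add (hη.memL2.const_smul (1 - κ))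
  have hw₂ : IsWeakDeriv (Ioo 0 T) (fun t => K (η₁ t)) (fun t => rieszInv L bc (η₂ t)) := by
    have h := hη.weakDeriv2.comp_clm ((toDual L bc).integrable_comp hη₁i) hη₂i (rieszInv L bc)
    simpa only [rieszInv_toDual] using h
  have heq : ∀ᵐ t ∂(volume.restrict (Ioo 0 T)),
      rieszInv L bc (η₂ t) + η t = K (j (w t + (1 - κ) • η t)) := by
    filter_upwards [hη.equation, hwf] with t h1 h2
    have h := congrArg (rieszInv L bc) h1
    rw [← h2, map_add, rieszInv_opA, rieszInv_toDual, ← hK, ← hj] at h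
    rw [map_add, map_add, ← h, map_smul, map_smul]
    module
  obtain ⟨⟨h, hc, he⟩, v, hvc, hve⟩ := abstract_regularity inner_adjH hT hηi hG.integrableOn
    ((rieszInv L bc).integrable_comp hη₂i) hη₁i hη.weakDeriv hw₂ heq hi₁ hi₂
  refine ⟨⟨fun t => domainOfH L bc κ (h t), continuous_domainOfH.comp_continuousOn hc, he⟩,
    ⟨v, hvc, hve⟩, ?_⟩
  -- By `opA_adjH` this represents `𝒜 η` in `H`, so `η'' = f - 𝒜 η` becomes an identity of functions
  -- with values in `H`.
  set A : ℝ → H L := fun t => h t + (κ - 1) • j (K (h t)) with hA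
  have hAc : ContinuousOn A (Icc 0 T) :=
    hc.add ((j.continuous.comp (K.continuous)).comp_continuousOn hc |>.const_smul (κ - 1))
  have hAm : MemL2 T A := by
    obtain ⟨C, hC⟩ := isCompact_Icc.exists_bound_of_continuousOn hAc
    refine MemLp.of_bound
      ((hAc.mono Ioo_subset_Icc_self).aestronglyMeasurable measurableSet_Ioo) C ?_
    filter_upwards [ae_restrict_mem measurableSet_Ioo] with t ht
      using hC t (Ioo_subset_Icc_self ht)
  refine ⟨fun t => j (w t) - A t, (j.comp_memLp' hw).sub hAm, ?_⟩
  filter_upwards [hη.equation, hwf, he] with t h1 h2 h3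
  rw [← h2, ← h3, opA_adjH] at h1
  rw [map_sub, eq_sub_of_add_eq h1]
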